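/- Let $S$ be a set of $n$ points in the plane $\mathbb{R}^2$, where $n$ is even, in general position (no three of the points are collinear). A line through two points of $S$ is a halving line if it splits the remaining $n-2$ points into two sets of equal size, i.e. if equally many points of $S$ lie on its two open sides. The underlying graph of $S$ is the graph with vertex set $S$ in which two distinct points are joined by an edge if and only if the line through them is a halving line. If, for some integer $k \ge 0$, the underlying graph contains a $k$-clique, then it has at least $\lfloor k^2/2 \rfloor$ vertices, that is, $n \ge \lfloor k^2/2 \rfloor$. Consequently, the largest clique of the underlying graph has at most $\sqrt{2n}+1$ vertices. -/

import Mathlib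

open Finset

noncomputable section

/-- The Euclidean plane `ℝ²`. -/
abbrev Plane : Type := EuclideanSpace ℝ (Fin 2)

/-- A finite set of points of the plane is in general position if no three distinct
points of it are collinear. -/
def InGeneralPosition (S : Finset Plane) : Prop :=
  ∀ p ∈ S, ∀ q ∈ S, ∀ r ∈ S, p ≠ q → p ≠ r → q ≠ r → ¬ Collinear ℝ {p, q, r}

/-- The cross product `(q - p) × (r - p)`. For `p ≠ q` it is positive if `r` lies strictly to the
left of the line directed from `p` to `q`, negative if `r` lies strictly to its right, and zero
if `r` lies on the line. -/
def cross (p q r : Plane) : ℝ :=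
  (q 0 - p 0) * (r 1 - p 1) - (q 1 - p 1) * (r 0 - p 0)

/-- The line through the distinct points `p` and `q` is a halving line of `S`: there are equally
many points of `S` on its two (open) sides. In general position, with `p, q ∈ S`, the points of
`S` that are not counted are exactly `p` and `q`. -/
def IsHalving (S : Finset Plane) (p q : Plane) : Prop :=
  p ≠ q ∧ #{r ∈ S | 0 < cross p q r} = #{r ∈ S | cross p q r < 0}

theorem cross_swap (p q r : Plane) : cross q p r = - cross p q r := by
  unfold cross; ring

theorem IsHalving.symm {S : Finset Plane} {p q : Plane} (h : IsHalving S p q) :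
    IsHalving S q p := by
  refine ⟨h.1.symm, ?_⟩
  simp only [cross_swap p q, Left.neg_pos_iff, Left.neg_neg_iff]
  exact h.2.symm

/-- The underlying graph of a finite set of points in the plane. Its vertices are the points
of `S` themselves (so it is a geometric graph), and two of them are joined by an edge iff the
line through them is a halving line of `S`. -/
def underlyingGraph (S : Finset Plane) : SimpleGraph S where
  Adj p q := IsHalving S p q
  symm := ⟨fun _ _ h => h.symm⟩
  loopless := ⟨fun _ h => h.1 rfl⟩

end

/-! Shear the plane so that first coordinates are distinct. Rotate a line about a point `p` of `S`:
the number of points above it drops by one at each point right of `p` and rises by one at each point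
left of `p`. Halving edges are the crossings between two fixed consecutive levels, so those to the
right and those to the left alternate and their numbers differ by at most one
(`card_isHalving_right_le_left`). Summed over the points left of a vertical cut, this bounds the
halving edges across the cut by the number of those points, and likewise on the right
(`card_edges_leaving_le`). A cut through the middle of a `k`-clique is crossed by at least
`⌊k/2⌋⌈k/2⌉` edges, so each side has at least that many points. -/

/-! ### Level crossings of a rotating line -/

open Classical in
/-- The number of elements of `T` lying above the line through `q`, where `m` records slopes and
`P` says which elements lie to the right of the pivot. -/
noncomputable def aboveCount {α : Type*} (T : Finset α) (m : α → ℝ) (P : α → Prop) (q : α) : ℕ :=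
  #{r ∈ T | (P r ∧ m q < m r) ∨ (¬ P r ∧ m r < m q)}

open Classical in
theorem aboveCount_insert {α : Type*} {T : Finset α} {m : α → ℝ} {P : α → Prop} {a q : α}
    (ha : a ∉ T) (hq : m q < m a) :
    aboveCount (insert a T) m P q = aboveCount T m P q + if P a then 1 else 0 := by
  unfold aboveCount
  rw [filter_insert]
  by_cases h : P a
  · simp [h, hq, ha]
  · simp [h, hq.not_gt]

open Classical in
theorem aboveCount_insert_self {α : Type*} {T : Finset α} {m : α → ℝ} {P : α → Prop} {a : α}
    (hlt : ∀ x ∈ T, m x < m a) :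
    aboveCount (insert a T) m P a = #{r ∈ T | ¬ P r} := by
  unfold aboveCount
  rw [filter_insert]
  simp only [lt_irrefl, and_false, or_self, if_false]
  congr 1
  apply filter_congr
  intro x hx
  simp [hlt x hx, (hlt x hx).le]

open Classical in
/-- Rotating a line about a pivot, the crossings of the level between `h + 1` and `h` in one
direction and in the other one balance up to the contribution of the initial and final levels. -/
theorem card_down_add_eq_card_up_add {α : Type*} (T : Finset α) (m : α → ℝ) (P : α → Prop)
    (hm : Set.InjOn m T) (h : ℤ) :
    #{q ∈ T | P q ∧ (aboveCount T m P q : ℤ) = h} +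
        (if h < (#{q ∈ T | ¬ P q} : ℤ) then 1 else 0) =
      #{q ∈ T | ¬ P q ∧ (aboveCount T m P q : ℤ) = h} +
        (if h < (#{q ∈ T | P q} : ℤ) then 1 else 0) := by
  induction T using Finset.induction_on_max_value m generalizing h with
  | empty => simp
  | insert a s ha hmax ih =>
    have hlt : ∀ x ∈ s, m x < m a := fun x hx =>
      lt_of_le_of_ne (hmax x hx) fun he =>
        ha (hm (by simp [hx]) (by simp) he ▸ hx)
    have ih := ih (hm.mono (by simp))
    have hself := aboveCount_insert_self (P := P) hlt
    have hold (Q : α → Prop) [DecidablePred Q] :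
        #{q ∈ s | Q q ∧ (aboveCount (insert a s) m P q : ℤ) = h} =
          #{q ∈ s | Q q ∧ (aboveCount s m P q : ℤ) = h - if P a then 1 else 0} := by
      congr 1
      apply filter_congr
      intro x hx
      rw [aboveCount_insert ha (hlt x hx), eq_sub_iff_add_eq]
      push_cast
      rfl
    simp only [filter_insert, hself]
    by_cases hP : P a
    -- A right point of maximal slope lies above every earlier line, so level `h` becomes `h - 1`,
    -- possibly negative: hence `h : ℤ`. A left one lies below them all.
    · have ih := ih (h - 1)
      have h1 := hold P
      have h2 := hold (fun q => ¬ P q)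
      simp only [hP, if_true] at h1 h2
      simp only [hP, true_and, not_true_eq_false, false_and, if_false, if_true]
      rw [card_insert_of_notMem (by simp [ha]), h2]
      by_cases h3 : ((#{q ∈ s | ¬ P q} : ℕ) : ℤ) = h
      · rw [if_pos h3, card_insert_of_notMem (by simp [ha]), h1]
        split_ifs at ih ⊢ <;> push_cast at * <;> omega
      · rw [if_neg h3, h1]
        split_ifs at ih ⊢ <;> push_cast at * <;> omega
    · have ih := ih h
      have h1 := hold P
      have h2 := hold (fun q => ¬ P q)
      simp only [hP, if_false, sub_zero] at h1 h2
      simp only [hP, not_false_eq_true, true_and, false_and, if_false, if_true]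
      rw [card_insert_of_notMem (by simp [ha]), h1]
      by_cases h3 : ((#{q ∈ s | ¬ P q} : ℕ) : ℤ) = h
      · rw [if_pos h3, card_insert_of_notMem (by simp [ha]), h2]
        split_ifs at ih ⊢ <;> push_cast at * <;> omega
      · rw [if_neg h3, h2]
        split_ifs at ih ⊢ <;> push_cast at * <;> omega

/-! ### Cross products and sheared slopes -/

theorem collinear_of_cross_eq_zero {p q r : Plane} (hpq : p ≠ q) (h : cross p q r = 0) :
    Collinear ℝ {p, q, r} := by
  rw [collinear_iff_of_mem (p₀ := p) (by simp)]
  refine ⟨q - p, ?_⟩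
  have key : ∃ t : ℝ, r = t • (q - p) + p := by
    unfold cross at h
    by_cases h0 : q 0 - p 0 = 0
    · have h1 : q 1 - p 1 ≠ 0 := fun h1 => hpq (by
        ext i; fin_cases i
        · exact (sub_eq_zero.1 h0).symm
        · exact (sub_eq_zero.1 h1).symm)
      refine ⟨(r 1 - p 1) / (q 1 - p 1), ?_⟩
      have h2 : r 0 - p 0 = 0 := by
        rw [h0, zero_mul, zero_sub, neg_eq_zero] at h
        exact (mul_eq_zero.1 h).resolve_left h1
      ext i; fin_cases i
      · simp [h0]; linarith
      · simp; field_simp; ring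
    · refine ⟨(r 0 - p 0) / (q 0 - p 0), ?_⟩
      ext i; fin_cases i
      · simp; field_simp; ring
      · simp; field_simp; linarith
  intro x hx
  simp only [Set.mem_insert_iff, Set.mem_singleton_iff] at hx
  rcases hx with rfl | rfl | rfl
  · exact ⟨0, by simp⟩
  · exact ⟨1, by simp⟩
  · simpa using key

theorem InGeneralPosition.cross_ne_zero {S : Finset Plane} (hS : InGeneralPosition S)
    {p q r : Plane} (hp : p ∈ S) (hq : q ∈ S) (hr : r ∈ S) (hpq : p ≠ q) (hpr : p ≠ r)
    (hqr : q ≠ r) : cross p q r ≠ 0 :=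
  fun h => hS p hp q hq r hr hpq hpr hqr (collinear_of_cross_eq_zero hpq h)

/-- A sheared first coordinate on the plane. -/
def shear (t : ℝ) (p : Plane) : ℝ := p 0 + t * p 1

theorem exists_injOn_shear (S : Finset Plane) : ∃ t : ℝ, Set.InjOn (shear t) S := by
  classical
  -- Each pair with distinct second coordinates forbids one `t`; for the other pairs division by
  -- zero only forbids `0`, which is harmless.
  obtain ⟨t, ht⟩ := Infinite.exists_notMem_finset
    ((S ×ˢ S).image fun x : Plane × Plane => -(x.1 0 - x.2 0) / (x.1 1 - x.2 1))
  refine ⟨t, fun p hp q hq h => ?_⟩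
  simp only [mem_image, mem_product, Prod.exists, not_exists, not_and, and_imp] at ht
  have h' := ht p q hp hq
  unfold shear at h
  have h1 : p 1 = q 1 := by
    by_contra hne
    apply h'
    rw [div_eq_iff (sub_ne_zero.2 hne)]
    linarith
  rw [h1] at h
  ext i; fin_cases i
  · simpa using h
  · exact h1

/-- The slope of the line through `p` and `q` in sheared coordinates. -/
noncomputable def shearSlope (t : ℝ) (p q : Plane) : ℝ := (q 1 - p 1) / (shear t q - shear t p)

/-- A shear has determinant one, so it preserves cross products. The side of a line thus depends
only on left/right position and the order of slopes. -/
theorem cross_eq_mul_shearSlope {t : ℝ} {p q r : Plane} (hq : shear t q ≠ shear t p)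
    (hr : shear t r ≠ shear t p) :
    cross p q r = (shear t q - shear t p) * (shear t r - shear t p) *
      (shearSlope t p r - shearSlope t p q) := by
  have hq := sub_ne_zero.2 hq
  have hr := sub_ne_zero.2 hr
  unfold shearSlope
  field_simp
  unfold cross shear
  ring

theorem cross_self_left (p q : Plane) : cross p q p = 0 := by unfold cross; ring

theorem cross_self_right (p q : Plane) : cross p q q = 0 := by unfold cross; ring

theorem card_cross_pos_add_card_cross_neg {S : Finset Plane} (hS : InGeneralPosition S)
    {p q : Plane} (hp : p ∈ S) (hq : q ∈ S) (hpq : p ≠ q) :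
    #{r ∈ S | 0 < cross p q r} + #{r ∈ S | cross p q r < 0} + 2 = #S := by
  classical
  have h0 : #{r ∈ S | cross p q r = 0} = 2 := by
    rw [← card_pair hpq]
    congr 1
    ext r
    simp only [mem_filter, mem_insert, mem_singleton]
    constructor
    · rintro ⟨hr, h⟩
      by_contra! hne
      exact hS.cross_ne_zero hp hq hr hpq hne.1.symm hne.2.symm h
    · rintro (rfl | rfl)
      · exact ⟨hp, cross_self_left _ _⟩
      · exact ⟨hq, cross_self_right _ _⟩
  rw [← h0, ← card_union_of_disjoint, ← card_union_of_disjoint]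
  · congr 1
    ext r
    have := lt_trichotomy (cross p q r) 0
    simp only [mem_union, mem_filter]
    tauto
  · rw [disjoint_left]
    simp only [mem_union, mem_filter]
    rintro r (⟨_, h⟩ | ⟨_, h⟩) ⟨_, h'⟩ <;> linarith
  · rw [disjoint_left]
    simp only [mem_filter]
    rintro r ⟨_, h⟩ ⟨_, h'⟩
    linarith

/-! ### Halving edges at a point -/

theorem isHalving_iff_aboveCount {S : Finset Plane} (hEven : Even #S) (hS : InGeneralPosition S)
    {t : ℝ} (ht : Set.InjOn (shear t) S) {p q : Plane} (hp : p ∈ S) (hq : q ∈ S.erase p) :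
    IsHalving S p q ↔
      (aboveCount (S.erase p) (shearSlope t p) (fun r => shear t p < shear t r) q : ℤ) =
        (#S / 2 : ℕ) - 1 := by
  classical
  have hqp := (mem_erase.1 hq).1
  have hqS := (mem_erase.1 hq).2
  have hsum := card_cross_pos_add_card_cross_neg hS hp hqS hqp.symm
  have hne {r : Plane} (hr : r ∈ S) (hrp : r ≠ p) : shear t r ≠ shear t p :=
    fun h => hrp (ht hr hp h)
  -- "Above" is the positive side if `q` is right of `p`, the negative side otherwise. Either count
  -- determines the other, as they sum to `#S - 2`.
  have hcount : aboveCount (S.erase p) (shearSlope t p) (fun r => shear t p < shear t r) q =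
      if shear t p < shear t q then #{r ∈ S | 0 < cross p q r} else
        #{r ∈ S | cross p q r < 0} := by
    unfold aboveCount
    have hq' := hne hqS hqp
    split_ifs with hlt
    · congr 1
      ext r
      simp only [mem_filter, mem_erase]
      by_cases hrp : r = p
      · subst hrp; simp [cross_self_left]
      by_cases hrS : r ∈ S
      · have hr' := hne hrS hrp
        rw [cross_eq_mul_shearSlope hq' hr', mul_assoc, mul_pos_iff_of_pos_left (sub_pos.2 hlt),
          mul_pos_iff]
        simp only [hrp, hrS, not_lt, sub_pos, sub_neg, hr'.le_iff_lt, ne_eq, not_false_eq_true,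
          true_and]
      · simp [hrS]
    · have hlt := lt_of_le_of_ne (not_lt.1 hlt) hq'
      congr 1
      ext r
      simp only [mem_filter, mem_erase]
      by_cases hrp : r = p
      · subst hrp; simp [cross_self_left]
      by_cases hrS : r ∈ S
      · have hr' := hne hrS hrp
        rw [cross_eq_mul_shearSlope hq' hr', mul_assoc, mul_neg_iff, mul_pos_iff]
        simp only [hrp, hrS, not_lt, sub_pos, sub_neg, hr'.le_iff_lt, ne_eq, not_false_eq_true,
          true_and, hlt, hlt.not_gt, false_and, false_or]
      · simp [hrS]
  obtain ⟨n, hn⟩ := hEven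
  unfold IsHalving
  rw [hcount]
  simp only [hqp.symm, ne_eq, not_false_eq_true, true_and]
  split_ifs <;> omega

theorem injOn_shearSlope {S : Finset Plane} (hS : InGeneralPosition S)
    {t : ℝ} (ht : Set.InjOn (shear t) S) {p : Plane} (hp : p ∈ S) [DecidableEq Plane] :
    Set.InjOn (shearSlope t p) (S.erase p) := by
  intro q hq r hr h
  rw [mem_coe, mem_erase] at hq hr
  by_contra hqr
  apply hS.cross_ne_zero hp hq.2 hr.2 hq.1.symm hr.1.symm hqr
  rw [cross_eq_mul_shearSlope (fun h => hq.1 (ht hq.2 hp h)) (fun h => hr.1 (ht hr.2 hp h)), h,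
    sub_self, mul_zero]

open Classical in
/-- The numbers of halving edges leaving a point to the right and to the left differ by at most
one. -/
theorem card_isHalving_right_le_left {S : Finset Plane} (hEven : Even #S)
    (hS : InGeneralPosition S) {t : ℝ} (ht : Set.InjOn (shear t) S) {p : Plane} (hp : p ∈ S) :
    #{q ∈ S | shear t p < shear t q ∧ IsHalving S p q} ≤
        #{q ∈ S | shear t q < shear t p ∧ IsHalving S p q} + 1 ∧
      #{q ∈ S | shear t q < shear t p ∧ IsHalving S p q} ≤
        #{q ∈ S | shear t p < shear t q ∧ IsHalving S p q} + 1 := by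
  have key := card_down_add_eq_card_up_add (S.erase p) (shearSlope t p)
    (fun r => shear t p < shear t r) (injOn_shearSlope hS ht hp) ((#S / 2 : ℕ) - 1)
  have h1 : ({q ∈ S | shear t p < shear t q ∧ IsHalving S p q} : Finset Plane) =
      {q ∈ S.erase p | shear t p < shear t q ∧ (aboveCount (S.erase p) (shearSlope t p)
        (fun r => shear t p < shear t r) q : ℤ) = (#S / 2 : ℕ) - 1} := by
    ext q
    by_cases hq : q ∈ S.erase p
    · simp only [mem_filter, hq, (mem_erase.1 hq).2, isHalving_iff_aboveCount hEven hS ht hp hq]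
    · simp only [mem_filter, hq, false_and, iff_false]
      rintro ⟨hqS, hlt, -⟩
      exact hq (mem_erase.2 ⟨fun h => by simp [h] at hlt, hqS⟩)
  have h2 : ({q ∈ S | shear t q < shear t p ∧ IsHalving S p q} : Finset Plane) =
      {q ∈ S.erase p | ¬ shear t p < shear t q ∧ (aboveCount (S.erase p) (shearSlope t p)
        (fun r => shear t p < shear t r) q : ℤ) = (#S / 2 : ℕ) - 1} := by
    ext q
    by_cases hq : q ∈ S.erase p
    · have hne : shear t q ≠ shear t p :=
        fun h => (mem_erase.1 hq).1 (ht (mem_erase.1 hq).2 hp h)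
      simp only [mem_filter, hq, (mem_erase.1 hq).2, isHalving_iff_aboveCount hEven hS ht hp hq,
        not_lt, hne.le_iff_lt]
    · simp only [mem_filter, hq, false_and, iff_false]
      rintro ⟨hqS, hlt, -⟩
      exact hq (mem_erase.2 ⟨fun h => by simp [h] at hlt, hqS⟩)
  rw [h1, h2]
  split_ifs at key <;> omega

/-! ### Edges across a cut -/

open Classical in
/-- If every vertex has at most one more upper than lower neighbour, then at most `#U` edges leave
the lower set `U`. -/
theorem card_edges_leaving_le {α : Type*} [DecidableEq α] {S U : Finset α} (hU : U ⊆ S) {R H : α → α → Prop}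
    (hH : ∀ p q, H p q → H q p)
    (hlow : ∀ p ∈ U, ∀ q ∈ S, R q p → q ∈ U) (hout : ∀ p ∈ U, ∀ q ∈ S \ U, R p q)
    (hdeg : ∀ p ∈ S, #{q ∈ S | R p q ∧ H p q} ≤ #{q ∈ S | R q p ∧ H p q} + 1) :
    #{x ∈ U ×ˢ (S \ U) | H x.1 x.2} ≤ #U := by
  have hsplit (p : α) (hp : p ∈ U) : #{q ∈ S | R p q ∧ H p q} =
      #{q ∈ U | R p q ∧ H p q} + #{q ∈ S \ U | H p q} := by
    rw [← card_union_of_disjoint]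
    · congr 1
      ext q
      have := hout p hp q
      have := @hU q
      simp only [mem_filter, mem_union, mem_sdiff] at *
      tauto
    · exact disjoint_filter_filter disjoint_sdiff
  have hlow' (p : α) (hp : p ∈ U) : #{q ∈ S | R q p ∧ H p q} = #{q ∈ U | R q p ∧ H p q} := by
    congr 1
    ext q
    have := hlow p hp q
    have := @hU q
    simp only [mem_filter]
    tauto
  -- Each edge inside `U` is counted once from either end, so these terms cancel.
  have hsum : ∑ p ∈ U, #{q ∈ U | R p q ∧ H p q} = ∑ p ∈ U, #{q ∈ U | R q p ∧ H p q} := by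
    simp only [card_filter]
    rw [sum_comm]
    refine sum_congr rfl fun p _ => sum_congr rfl fun q _ => ?_
    have : H p q ↔ H q p := ⟨hH p q, hH q p⟩
    simp only [this]
  have hcross : #{x ∈ U ×ˢ (S \ U) | H x.1 x.2} = ∑ p ∈ U, #{q ∈ S \ U | H p q} := by
    simp only [card_filter]
    rw [sum_product]
  have hle : ∑ p ∈ U, (#{q ∈ U | R p q ∧ H p q} + #{q ∈ S \ U | H p q}) ≤
      ∑ p ∈ U, (#{q ∈ U | R q p ∧ H p q} + 1) := sum_le_sum fun p hp => by
    rw [← hsplit p hp, ← hlow' p hp]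
    exact hdeg p (hU hp)
  rw [sum_add_distrib, sum_add_distrib, hsum, ← hcross, sum_const, smul_eq_mul, mul_one] at hle
  omega

theorem exists_card_filter_lt_eq {α : Type*} (A : Finset α) (f : α → ℝ) (hf : Set.InjOn f A)
    {j : ℕ} (hj : j ≤ #A) : ∃ c : ℝ, #{x ∈ A | f x < c} = j := by
  classical
  induction A using Finset.induction_on_max_value f with
  | empty => exact ⟨0, by simp at hj; simp [hj]⟩
  | insert a s ha hmax ih =>
    have hlt : ∀ x ∈ s, f x < f a := fun x hx =>
      lt_of_le_of_ne (hmax x hx) fun he => ha (hf (by simp [hx]) (by simp) he ▸ hx)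
    rw [card_insert_of_notMem ha] at hj
    rcases hj.lt_or_eq with hj | rfl
    · obtain ⟨c, hc⟩ := ih (hf.mono (by simp)) (by omega)
      -- Capping at `f a` excludes `a` and loses no element of `s`.
      refine ⟨min c (f a), ?_⟩
      rw [filter_insert, if_neg (by simp), ← hc]
      congr 1
      apply filter_congr
      intro x hx
      simp [hlt x hx]
    · refine ⟨f a + 1, ?_⟩
      rw [filter_true_of_mem, card_insert_of_notMem ha]
      intro x hx
      rcases mem_insert.1 hx with rfl | hx
      · linarith
      · linarith [hlt x hx]

/-! ### Cliques -/

theorem sq_div_two_le_card_of_clique {S : Finset Plane} (hEven : Even #S)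
    (hS : InGeneralPosition S) {K : Finset Plane} (hK : K ⊆ S)
    (hclique : ∀ p ∈ K, ∀ q ∈ K, p ≠ q → IsHalving S p q) : #K ^ 2 / 2 ≤ #S := by
  classical
  obtain ⟨t, ht⟩ := exists_injOn_shear S
  obtain ⟨c, hc⟩ := exists_card_filter_lt_eq K (shear t) (ht.mono (by exact_mod_cast hK))
    (Nat.div_le_self #K 2)
  set U : Finset Plane := {p ∈ S | shear t p < c} with hUdef
  have hUS : U ⊆ S := filter_subset _ _
  have hmem (p : Plane) : p ∈ U ↔ p ∈ S ∧ shear t p < c := by simp [hUdef]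
  have hsymm : ∀ p q, IsHalving S p q → IsHalving S q p := fun _ _ h => h.symm
  have hleft := card_edges_leaving_le hUS (R := fun p q => shear t p < shear t q) hsymm
    (fun p hp q hq h => (hmem q).2 ⟨hq, h.trans ((hmem p).1 hp).2⟩)
    (fun p hp q hq => by
      simp only [mem_sdiff, hmem, not_and, not_lt] at hp hq
      exact hp.2.trans_le (hq.2 hq.1))
    (fun p hp => (card_isHalving_right_le_left hEven hS ht hp).1)
  -- The same bound with left and right exchanged.
  have hright := card_edges_leaving_le (sdiff_subset : S \ U ⊆ S)
    (R := fun p q => shear t q < shear t p) hsymm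
    (fun p hp q hq h => by
      simp only [mem_sdiff, hmem, not_and, not_lt] at hp ⊢
      exact ⟨hq, fun _ => (hp.2 hp.1).trans h.le⟩)
    (fun p hp q hq => by
      rw [Finset.sdiff_sdiff_eq_self hUS] at hq
      simp only [mem_sdiff, hmem, not_and, not_lt] at hp hq
      exact hq.2.trans_le (hp.2 hp.1))
    (fun p hp => (card_isHalving_right_le_left hEven hS ht hp).2)
  rw [Finset.sdiff_sdiff_eq_self hUS] at hright
  have hKU : #{p ∈ K | ¬ shear t p < c} = #K - #K / 2 := by
    have := card_filter_add_card_filter_not (s := K) (fun p => shear t p < c)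
    omega
  have hU' {p : Plane} (hp : p ∈ K) (h : ¬ shear t p < c) : p ∈ S \ U :=
    mem_sdiff.2 ⟨hK hp, fun h' => h ((hmem p).1 h').2⟩
  have h1 : (#K / 2) * (#K - #K / 2) ≤ #U := by
    refine le_trans ?_ hleft
    rw [← hKU, ← hc, ← card_product]
    refine card_le_card fun x hx => ?_
    simp only [mem_product, mem_filter] at hx
    obtain ⟨⟨h1, h2⟩, h3, h4⟩ := hx
    refine mem_filter.2 ⟨mem_product.2 ⟨(hmem _).2 ⟨hK h1, h2⟩, hU' h3 h4⟩, ?_⟩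
    exact hclique _ h1 _ h3 fun h => h4 (h ▸ h2)
  have h2 : (#K / 2) * (#K - #K / 2) ≤ #(S \ U) := by
    refine le_trans ?_ hright
    rw [mul_comm, ← hKU, ← hc, ← card_product]
    refine card_le_card fun x hx => ?_
    simp only [mem_product, mem_filter] at hx
    obtain ⟨⟨h1, h2⟩, h3, h4⟩ := hx
    refine mem_filter.2 ⟨mem_product.2 ⟨hU' h1 h2, (hmem _).2 ⟨hK h3, h4⟩⟩, ?_⟩
    exact hclique _ h1 _ h3 fun h => h2 (h ▸ h4)
  have h3 := card_sdiff_add_card_eq_card hUS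
  -- Equality in fact holds: halving the clique loses only the rounding when its size is odd.
  have h4 : #K ^ 2 / 2 ≤ 2 * ((#K / 2) * (#K - #K / 2)) := by
    rcases Nat.even_or_odd' #K with ⟨m, hm | hm⟩
    · have e1 : #K / 2 = m := by omega
      have e2 : #K - m = m := by omega
      rw [e1, e2, hm]
      have : (2 * m) ^ 2 = 4 * (m * m) := by ring
      omega
    · have e1 : #K / 2 = m := by omega
      have e2 : #K - m = m + 1 := by omega
      rw [e1, e2, hm]
      have : (2 * m + 1) ^ 2 = 4 * (m * (m + 1)) + 1 := by ring
      omega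
  omega

theorem sq_div_two_le_card_of_isNClique {S : Finset Plane} (hEven : Even #S)
    (hS : InGeneralPosition S) {k : ℕ} {K : Finset S}
    (hK : (underlyingGraph S).IsNClique k K) : k ^ 2 / 2 ≤ #S := by
  rw [← hK.card_eq, ← card_map (Function.Embedding.subtype (· ∈ S))]
  apply sq_div_two_le_card_of_clique hEven hS
  · intro x hx
    obtain ⟨y, -, rfl⟩ := mem_map.1 hx
    exact y.2
  · intro p hp q hq hpq
    obtain ⟨p, hp', rfl⟩ := mem_map.1 hp
    obtain ⟨q, hq', rfl⟩ := mem_map.1 hq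
    exact hK.isClique hp' hq' fun h => hpq (by rw [h])

theorem mainTheorem4 (S : Finset Plane) (hEven : Even S.card) (hS : InGeneralPosition S) :
    (∀ k : ℕ, (∃ K : Finset S, (underlyingGraph S).IsNClique k K) →
      ⌊(k : ℝ) ^ 2 / 2⌋₊ ≤ S.card) ∧
    ((underlyingGraph S).cliqueNum : ℝ) ≤ Real.sqrt (2 * (S.card : ℝ)) + 1 := by
  constructor
  · rintro k ⟨K, hK⟩
    have h : ⌊(k : ℝ) ^ 2 / 2⌋₊ = k ^ 2 / 2 := by
      have := Nat.floor_div_eq_div (K := ℝ) (k ^ 2) 2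
      push_cast at this
      exact this
    rw [h]
    exact sq_div_two_le_card_of_isNClique hEven hS hK
  · obtain ⟨K, hK⟩ := (underlyingGraph S).exists_isNClique_cliqueNum
    have h := sq_div_two_le_card_of_isNClique hEven hS hK
    set k := (underlyingGraph S).cliqueNum
    -- The floor costs at most one, which the square of `√(2n) + 1` absorbs.
    have h1 : k ^ 2 ≤ 2 * #S + 1 := by omega
    have h2 : (k : ℝ) ^ 2 ≤ 2 * (#S : ℝ) + 1 := by exact_mod_cast h1
    refine (pow_le_pow_iff_left₀ (by positivity) (by positivity) two_ne_zero).1 ?_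
    have h3 : Real.sqrt (2 * (#S : ℝ)) ^ 2 = 2 * (#S : ℝ) := Real.sq_sqrt (by positivity)
    nlinarith [Real.sqrt_nonneg (2 * (#S : ℝ))]
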